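/- **Proposition.** Let $k$ be an algebraically closed field of characteristic $0$ and let $\Gamma=(p_1,\dots,p_{2n})$ be an ordered set of $2n$ distinct points in $\mathbb{P}^{n-1}_k$. Let $C\subset\mathbb{A}^n$ be the cone over $\Gamma$ (a union of $2n$ lines through the origin, a curve $L_{2n}^n$), with homogeneous ideal $I\subset P=k[x_1,\dots,x_n]$ and coordinate ring $\mathcal{O}=P/I$. Assume 1. $\Gamma$ is self-associated: there are $n\times 2n$ matrices $A$, $B$ of rank $n$ with $AB^t=0$ such that the columns of $A$ are homogeneous coordinates of the points of $\Gamma$, and the columns of $B$ are homogeneous coordinates of an ordered point set (the Gale transform of $\Gamma$) that is projectively equivalent to $\Gamma$; 2. $C$ is Gorenstein: its dualising module $\omega$ is free of rank one, $\omega\cong\mathcal{O}$. Here $\omega$ consists of the rational differentials $\alpha=(\alpha_i\,dt_i)_i$, $\alpha_i\in k[t_i,t_i^{-1}]$, on the normalisation (the disjoint union of the lines, with parameters $t_i$) such that $\sum_i \operatorname{res}_{t_i=0}(f\alpha_i\,dt_i)=0$ for all $f\in\mathcal{O}$. Let $T^1=\operatorname{Coker}\bigl(\operatorname{Der}_k(P,\mathcal{O})\to\operatorname{Hom}_P(I,\mathcal{O})\bigr)$,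 and for $\ell\in\mathbb{Z}$ let $T^1_\ell$ be the image in $T^1$ of the homomorphisms that map $I_d$ to $\mathcal{O}_{d+\ell}$ for all $d$. Then $C$ is negatively graded: $T^1_\ell=0$ for all $\ell>0$. -/

import Mathlib

open scoped LinearAlgebra.Projectivization LaurentPolynomial

namespace LinesCone

noncomputable section

/-! ### Gale transforms and self-associated point sets -/

/-- The columns of the matrix `P` are homogeneous coordinates of the points `p i`. -/
def IsCoordinateMatrix {k : Type*} [Field k] {n r : ℕ} (P : Matrix (Fin n) (Fin r) k)
    (p : Fin r → ℙ k (Fin n → k)) : Prop :=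
  ∀ i, ∃ h : P.col i ≠ 0, Projectivization.mk k (P.col i) h = p i

/-- The ordered points `q` in `ℙ^(m-1)` are a Gale transform of the `r = n + m` ordered points `p`
in `ℙ^(n-1)`: there are coordinate matrices `P`, `Q` of full ranks `n` and `m = r - n` such that
`P Qᵗ = 0`, i.e. the rows of `Q` are a basis of the orthogonal complement of the rows of `P`. -/
def IsGaleTransform {k : Type*} [Field k] {n m r : ℕ}
    (p : Fin r → ℙ k (Fin n → k)) (q : Fin r → ℙ k (Fin m → k)) : Prop :=
  n + m = r ∧ ∃ (P : Matrix (Fin n) (Fin r) k) (Q : Matrix (Fin m) (Fin r) k),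
    IsCoordinateMatrix P p ∧ IsCoordinateMatrix Q q ∧ P.rank = n ∧ Q.rank = m ∧
      P * Q.transpose = 0

/-- Two ordered point sets differ by a projective transformation. -/
def ProjectivelyEquivalent {k : Type*} [Field k] {n r : ℕ}
    (p q : Fin r → ℙ k (Fin n → k)) : Prop :=
  ∃ g : (Fin n → k) ≃ₗ[k] (Fin n → k),
    ∀ i, Projectivization.map (g : (Fin n → k) →ₗ[k] (Fin n → k)) g.injective (p i) = q i

/-- `2n` ordered points in `ℙ^(n-1)` are self-associated if their Gale transform is projectively
equivalent to them. -/
def IsSelfAssociated {k : Type*} [Field k] {n : ℕ} (p : Fin (2 * n) → ℙ k (Fin n → k)) : Prop :=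
  ∃ q : Fin (2 * n) → ℙ k (Fin n → k), IsGaleTransform p q ∧ ProjectivelyEquivalent p q

/-! ### The cone over a point set and its dualising module -/

/-- The cone in affine `n`-space over a point set: the union of the corresponding lines. -/
def cone {k : Type*} [Field k] {n r : ℕ} (p : Fin r → ℙ k (Fin n → k)) : Set (Fin n → k) :=
  ⋃ i, ((p i).submodule : Set (Fin n → k))

/-- The ideal `I` of the cone in `k[x₁, …, xₙ]`; its coordinate ring is `𝒪 = k[x₁, …, xₙ] / I`. -/
def coneIdeal {k : Type*} [Field k] {n r : ℕ} (p : Fin r → ℙ k (Fin n → k)) :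
    Ideal (MvPolynomial (Fin n) k) :=
  MvPolynomial.vanishingIdeal k (cone p)

/-- Restriction of polynomial functions to the lines of the cone, the `i`-th line being
parametrised by `t ↦ t • vᵢ`, with `vᵢ` a coordinate vector of the `i`-th point. -/
def restrictToLines {k : Type*} [Field k] {n r : ℕ} (p : Fin r → ℙ k (Fin n → k)) :
    MvPolynomial (Fin n) k →ₐ[k] (Fin r → k[T;T⁻¹]) :=
  MvPolynomial.aeval fun j i => LaurentPolynomial.C ((p i).rep j) * LaurentPolynomial.T 1

/-- The rational differentials `(α₁ dt₁, …, αᵣ dtᵣ)` on the normalisation (the disjoint union of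
the lines) without poles outside the points over the origin; the entry `α i : k[T;T⁻¹]` stands for
the differential `α i dtᵢ`. -/
def LineDifferentials {k : Type*} [Field k] {n r : ℕ} (_p : Fin r → ℙ k (Fin n → k)) : Type _ :=
  Fin r → k[T;T⁻¹]

instance {k : Type*} [Field k] {n r : ℕ} (p : Fin r → ℙ k (Fin n → k)) :
    AddCommGroup (LineDifferentials p) :=
  inferInstanceAs (AddCommGroup (Fin r → k[T;T⁻¹]))

/-- Polynomials act on differentials through their restrictions to the lines. -/
instance {k : Type*} [Field k] {n r : ℕ} (p : Fin r → ℙ k (Fin n → k)) :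
    Module (MvPolynomial (Fin n) k) (LineDifferentials p) :=
  Module.compHom (Fin r → k[T;T⁻¹]) (restrictToLines p).toRingHom

/-- The sum over all lines of the residues at the point over the origin. -/
def residueSum {k : Type*} [Field k] {n r : ℕ} (p : Fin r → ℙ k (Fin n → k)) :
    LineDifferentials p →+ k where
  toFun α := ∑ i, (α i).coeff (-1)
  map_zero' := Finset.sum_eq_zero fun _ _ => rfl
  map_add' α β := by
    rw [← Finset.sum_add_distrib]
    rfl

/-- The dualising module `ω` of the cone in terms of Rosenlicht differentials: those `α` for which
the sum of the residues of `f α` vanishes for every `f ∈ 𝒪`. -/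
def dualisingModule {k : Type*} [Field k] {n r : ℕ} (p : Fin r → ℙ k (Fin n → k)) :
    Submodule (MvPolynomial (Fin n) k) (LineDifferentials p) where
  carrier := {α | ∀ f : MvPolynomial (Fin n) k, residueSum p (f • α) = 0}
  zero_mem' f := by rw [smul_zero, map_zero]
  add_mem' hα hβ f := by rw [smul_add, map_add, hα f, hβ f, add_zero]
  smul_mem' g α hα f := by rw [smul_smul]; exact hα (f * g)

/-- The cone is Gorenstein: its dualising module is free of rank one, `ω ≅ 𝒪`. -/
def IsGorensteinCone {k : Type*} [Field k] {n r : ℕ} (p : Fin r → ℙ k (Fin n → k)) : Prop :=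
  Nonempty (dualisingModule p ≃ₗ[MvPolynomial (Fin n) k]
    (MvPolynomial (Fin n) k ⧸ coneIdeal p))

/-! ### Infinitesimal deformations -/

/-- The map `Θₙ ⊗ 𝒪 = Der_k(k[x₁, …, xₙ], 𝒪) → Hom(I, 𝒪)` that restricts a derivation to `I`,
where `𝒪 = k[x₁, …, xₙ] / I`. -/
def jacobianMap {k : Type*} [Field k] {n : ℕ} (I : Ideal (MvPolynomial (Fin n) k)) :
    Derivation k (MvPolynomial (Fin n) k) (MvPolynomial (Fin n) k ⧸ I)
      →ₗ[MvPolynomial (Fin n) k] (I →ₗ[MvPolynomial (Fin n) k] (MvPolynomial (Fin n) k ⧸ I)) where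
  toFun D :=
    { toFun := fun f => D f
      map_add' := fun f g => by simp
      map_smul' := fun a f => by
        have h : (f : MvPolynomial (Fin n) k) • D a = 0 := by
          obtain ⟨g, hg⟩ := Ideal.Quotient.mk_surjective (D a)
          rw [← hg]
          exact Ideal.Quotient.eq_zero_iff_mem.mpr (I.mul_mem_right g f.2)
        simp [h] }
  map_add' D E := rfl
  map_smul' a D := rfl

/-- `T¹ = Coker (Θₙ ⊗ 𝒪 → Hom(I, 𝒪))`. -/
abbrev T1 {k : Type*} [Field k] {n : ℕ} (I : Ideal (MvPolynomial (Fin n) k)) : Type _ :=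
  (I →ₗ[MvPolynomial (Fin n) k] (MvPolynomial (Fin n) k ⧸ I)) ⧸ LinearMap.range (jacobianMap I)

/-- The part of degree `e : ℤ` of `𝒪 = k[x₁, …, xₙ] / I`: the classes of the forms of degree `e`
(only `0` if `e < 0`). -/
def quotientPart {k : Type*} [Field k] {n : ℕ} (I : Ideal (MvPolynomial (Fin n) k)) (e : ℤ) :
    Submodule k (MvPolynomial (Fin n) k ⧸ I) :=
  if 0 ≤ e then
    (MvPolynomial.homogeneousSubmodule (Fin n) k e.toNat).map (Ideal.Quotient.mkₐ k I).toLinearMap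
  else ⊥

/-- `Hom(I, 𝒪)_ℓ`: the homomorphisms that map the forms of degree `d` in `I` to `𝒪_{d + ℓ}`. -/
def normalPart {k : Type*} [Field k] {n : ℕ} (I : Ideal (MvPolynomial (Fin n) k)) (l : ℤ) :
    Submodule k (I →ₗ[MvPolynomial (Fin n) k] (MvPolynomial (Fin n) k ⧸ I)) where
  carrier := {φ | ∀ (d : ℕ) (f : I), (f : MvPolynomial (Fin n) k).IsHomogeneous d →
    φ f ∈ quotientPart I (d + l)}
  zero_mem' _ _ _ := Submodule.zero_mem _
  add_mem' hφ hψ d f hf := Submodule.add_mem _ (hφ d f hf) (hψ d f hf)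
  smul_mem' c _ hφ d f hf := Submodule.smul_mem _ c (hφ d f hf)

/-- `T¹_ℓ`, the part of degree `ℓ` of `T¹`: the image of `Hom(I, 𝒪)_ℓ`. -/
def T1Part {k : Type*} [Field k] {n : ℕ} (I : Ideal (MvPolynomial (Fin n) k)) (l : ℤ) :
    Submodule k (T1 I) :=
  (normalPart I l).map
    ((LinearMap.range (jacobianMap I)).mkQ.restrictScalars k)

/-- Negatively graded: `T¹` has no nonzero parts of positive degree. -/
def IsNegativelyGraded {k : Type*} [Field k] {n : ℕ} (I : Ideal (MvPolynomial (Fin n) k)) : Prop :=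
  ∀ l : ℤ, 0 < l → T1Part I l = ⊥

end

end LinesCone

/-! Let `v j` span the `j`-th line and let `φ : I → 𝒪` have degree `l > 0`. Away from the origin the
cone is smooth, so at `v j` the map `φ` is differentiation along some vector `w j`
(`exists_directionalDerivative`). On forms in `I`, changing `w j` by a multiple of `v j` has no
effect, by Euler's formula. Hence `φ` comes from a derivation once forms `Y i` of degree `l + 1 ≥ 2`
take the values `w j i + c j * v j i` at `v j`, for some scalars `c j`.

The obstruction to interpolating by forms of a given degree is the space of weights annihilating
their values. Self-association gives nonzero weights `lam` annihilating all quadrics, and makes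
every linear relation between the `v j` a linear form times `lam`. The Gorenstein property makes
`lam` unique up to a scalar (`IsGorensteinCone.exists_eq_mul_weight`): for another such `u`,
multiplying a generator of `ω` by `u j / lam j` on each line stays in `ω`, so these ratios are
restrictions of one function and agree at the origin. The only condition left is that the
`lam`-weighted sum of the target vectors vanishes. The `c j` achieve this because the `v j` span the
space. -/

namespace LinesCone

section

open MvPolynomial

variable {k : Type*} [Field k] {n r : ℕ}

/-! ### Directional derivatives and the ideal of a single line -/

/-- The derivative of `f` at the point `v` in the direction `w`. -/
noncomputable def directionalDerivative (v w : Fin n → k) : MvPolynomial (Fin n) k →ₗ[k] k where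
  toFun f := ∑ i, eval v (pderiv i f) * w i
  map_add' f g := by simp [add_mul, Finset.sum_add_distrib]
  map_smul' c f := by simp [smul_eval, mul_assoc, Finset.mul_sum]

theorem directionalDerivative_apply (v w : Fin n → k) (f : MvPolynomial (Fin n) k) :
    directionalDerivative v w f = ∑ i, eval v (pderiv i f) * w i := rfl

theorem directionalDerivative_mul (v w : Fin n → k) (f g : MvPolynomial (Fin n) k) :
    directionalDerivative v w (f * g) =
      eval v f * directionalDerivative v w g + eval v g * directionalDerivative v w f := by
  simp only [directionalDerivative_apply, Finset.mul_sum, ← Finset.sum_add_distrib]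
  refine Finset.sum_congr rfl fun i _ => ?_
  simp [Derivation.leibniz]
  ring

theorem directionalDerivative_X (v w : Fin n → k) (i : Fin n) :
    directionalDerivative v w (X i) = w i := by
  simp [directionalDerivative_apply, pderiv_X, Pi.single_apply, apply_ite]

theorem directionalDerivative_C (v w : Fin n → k) (c : k) :
    directionalDerivative v w (C c) = 0 := by
  simp [directionalDerivative_apply]

theorem directionalDerivative_self {d : ℕ} (v : Fin n → k) {f : MvPolynomial (Fin n) k}
    (hf : f.IsHomogeneous d) : directionalDerivative v v f = d * eval v f := by
  have h := congrArg (eval v) hf.sum_X_mul_pderiv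
  simpa [directionalDerivative_apply, mul_comm] using h

/-- The ideal of a line through the origin is generated by linear forms. -/
theorem mem_span_linear_of_vanishes_on_line [Infinite k] {v : Fin n → k} {s : Fin n}
    {f : MvPolynomial (Fin n) k} (hf : ∀ t : k, eval (t • v) f = 0) :
    f ∈ Ideal.span (Set.range fun i => X i - C (v i / v s) * X s) := by
  set J := Ideal.span (Set.range fun i => (X i - C (v i / v s) * X s : MvPolynomial (Fin n) k))
  -- If `v s ≠ 0`, this is the projection onto the line using the coordinate `x_s`; it kills `f` and
  -- is the identity modulo `J`. If `v s = 0`, the quotients are `0`, `σ` is evaluation at the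
  -- origin, and the same argument applies.
  let σ : MvPolynomial (Fin n) k →ₐ[k] MvPolynomial (Fin n) k :=
    aeval fun i => C (v i / v s) * X s
  have h0 : σ f = 0 := by
    apply MvPolynomial.funext
    intro x
    have h1 : eval x (σ f) = eval ((x s / v s) • v) f := by
      have h : (aeval x).comp σ = aeval ((x s / v s) • v) := by
        apply MvPolynomial.algHom_ext
        intro i
        simp only [σ, AlgHom.comp_apply, aeval_X, map_mul, aeval_C, Algebra.algebraMap_self,
          RingHom.id_apply, Pi.smul_apply, smul_eq_mul]
        ring
      simpa [aeval_eq_eval] using DFunLike.congr_fun h f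
    rw [h1, hf, map_zero]
  have h2 : (Ideal.Quotient.mkₐ k J).comp σ = Ideal.Quotient.mkₐ k J := by
    apply MvPolynomial.algHom_ext
    intro i
    simp only [σ, AlgHom.comp_apply, aeval_X, Ideal.Quotient.mkₐ_eq_mk]
    refine ((Ideal.Quotient.mk_eq_mk_iff_sub_mem _ _).mpr ?_).symm
    exact Ideal.subset_span ⟨i, rfl⟩
  have h3 := DFunLike.congr_fun h2 f
  rw [AlgHom.comp_apply, h0, map_zero] at h3
  exact Ideal.Quotient.eq_zero_iff_mem.mp h3.symm

/-- A linear functional on the ideal of a line that is linear over polynomials acting through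
evaluation at a point `v` of the line is a directional derivative at `v`. -/
theorem exists_directionalDerivative_of_line [Infinite k] {v : Fin n → k} (hv : v ≠ 0)
    (J : Ideal (MvPolynomial (Fin n) k))
    (hJ : ∀ f, f ∈ J ↔ ∀ t : k, eval (t • v) f = 0)
    (χ : J → k) (hadd : ∀ f g, χ (f + g) = χ f + χ g)
    (hsmul : ∀ (a : MvPolynomial (Fin n) k) f, χ (a • f) = eval v a * χ f) :
    ∃ w : Fin n → k, ∀ f : J, χ f = directionalDerivative v w f := by
  obtain ⟨s, hs⟩ := Function.ne_iff.mp hv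
  replace hs : v s ≠ 0 := hs
  have hmem : ∀ i, (X i - C (v i / v s) * X s : MvPolynomial (Fin n) k) ∈ J := by
    intro i
    rw [hJ]
    intro t
    simp
    field_simp
    ring
  have hspan : ∀ f ∈ J, f ∈ Ideal.span (Set.range fun i =>
      (X i - C (v i / v s) * X s : MvPolynomial (Fin n) k)) := fun f hf =>
    mem_span_linear_of_vanishes_on_line ((hJ f).mp hf)
  have hle : ∀ f ∈ Ideal.span (Set.range fun i =>
      (X i - C (v i / v s) * X s : MvPolynomial (Fin n) k)), f ∈ J := fun f hf =>
    (Ideal.span_le.mpr (by rintro _ ⟨i, rfl⟩; exact hmem i)) hf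
  have hev : ∀ f ∈ J, eval v f = 0 := fun f hf => by simpa using (hJ f).mp hf 1
  have hzero : χ 0 = 0 := by simpa using hadd 0 0
  -- Since `w s = 0`, the derivative of the `i`-th generator along `w` is `w i`, which forces this
  -- choice.
  let w : Fin n → k := fun i => χ ⟨_, hmem i⟩
  have hws : w s = 0 := by
    have : (⟨_, hmem s⟩ : J) = 0 := by
      ext1
      simp [hs]
    simp only [w, this, hzero]
  refine ⟨w, fun ⟨f, hf⟩ => ?_⟩
  suffices H : ∀ f (hf : f ∈ Ideal.span (Set.range fun i =>
      (X i - C (v i / v s) * X s : MvPolynomial (Fin n) k))),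
      χ ⟨f, hle f hf⟩ = directionalDerivative v w f from H f (hspan f hf)
  intro f hf
  induction hf using Submodule.span_induction with
  | mem f hf =>
    obtain ⟨i, rfl⟩ := hf
    simp only [map_sub, directionalDerivative_mul, directionalDerivative_X,
      directionalDerivative_C, hws]
    simp [w]
  | zero => exact hzero.trans (map_zero _).symm
  | add f g hf hg ihf ihg =>
    rw [map_add, ← ihf, ← ihg, ← hadd]
    rfl
  | smul a f hf ih =>
    refine (hsmul a ⟨f, hle f hf⟩).trans ?_
    rw [ih, smul_eq_mul, directionalDerivative_mul, hev f (hle f hf), zero_mul, add_zero]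

/-- Distinct lines are separated by a form that vanishes on one of them. -/
theorem exists_linear_separating {p q : ℙ k (Fin n → k)} (h : p ≠ q) :
    ∃ L : Fin n → k, L ⬝ᵥ p.rep = 0 ∧ L ⬝ᵥ q.rep ≠ 0 := by
  have hq : q.rep ∉ k ∙ p.rep := by
    intro hq
    obtain ⟨a, ha⟩ := Submodule.mem_span_singleton.mp hq
    apply h
    rw [← p.mk_rep, ← q.mk_rep]
    exact ((Projectivization.mk_eq_mk_iff' k _ _ q.rep_nonzero p.rep_nonzero).mpr ⟨a, ha⟩).symm
  obtain ⟨φ, hφ, hle⟩ := Submodule.exists_le_ker_of_notMem hq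
  refine ⟨fun i => φ fun j => if i = j then 1 else 0, ?_, ?_⟩
  · have := hle (Submodule.mem_span_singleton_self p.rep)
    rw [LinearMap.mem_ker, LinearMap.pi_apply_eq_sum_univ] at this
    simpa [dotProduct, mul_comm] using this
  · rw [LinearMap.pi_apply_eq_sum_univ] at hφ
    simpa [dotProduct, mul_comm] using hφ

/-! ### The ideal of the cone and its smooth points -/

/-- The linear form with the given coefficients. -/
noncomputable def linearForm (L : Fin n → k) : MvPolynomial (Fin n) k := ∑ i, C (L i) * X i

theorem eval_linearForm (L x : Fin n → k) : eval x (linearForm L) = L ⬝ᵥ x := by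
  simp [linearForm, dotProduct]

theorem linearForm_isHomogeneous (L : Fin n → k) : (linearForm L).IsHomogeneous 1 :=
  IsHomogeneous.sum _ _ _ fun i _ => isHomogeneous_C_mul_X _ i

theorem mem_coneIdeal {p : Fin r → ℙ k (Fin n → k)} {f : MvPolynomial (Fin n) k} :
    f ∈ coneIdeal p ↔ ∀ j (t : k), eval (t • (p j).rep) f = 0 := by
  simp only [coneIdeal, mem_vanishingIdeal_iff, cone, Set.mem_iUnion, SetLike.mem_coe,
    Projectivization.submodule_eq, Submodule.mem_span_singleton, aeval_eq_eval]
  constructor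
  · intro h j t
    exact h _ ⟨j, t, rfl⟩
  · rintro h _ ⟨j, t, rfl⟩
    exact h j t

theorem eval_smul_of_isHomogeneous {d : ℕ} {f : MvPolynomial (Fin n) k} (hf : f.IsHomogeneous d)
    (t : k) (x : Fin n → k) : eval (t • x) f = t ^ d * eval x f := by
  simp only [eval_eq', Finset.mul_sum, Pi.smul_apply, smul_eq_mul, mul_pow,
    Finset.prod_mul_distrib]
  refine Finset.sum_congr rfl fun m hm => ?_
  have h : m.degree = d := (hf.degree_eq_sum_deg_support hm).symm
  rw [Finset.prod_pow_eq_pow_sum, ← Finsupp.degree_eq_sum, h]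
  ring

theorem mem_coneIdeal_of_isHomogeneous {p : Fin r → ℙ k (Fin n → k)} {d : ℕ}
    {f : MvPolynomial (Fin n) k} (hf : f.IsHomogeneous d) (h : ∀ j, eval (p j).rep f = 0) :
    f ∈ coneIdeal p :=
  mem_coneIdeal.mpr fun j t => by rw [eval_smul_of_isHomogeneous hf, h, mul_zero]

/-- Evaluation of functions on the cone at the chosen point of the `j`-th line. -/
noncomputable def evalAt (p : Fin r → ℙ k (Fin n → k)) (j : Fin r) :
    (MvPolynomial (Fin n) k ⧸ coneIdeal p) →+* k :=
  Ideal.Quotient.lift _ (eval (p j).rep) fun f hf => by simpa using mem_coneIdeal.mp hf j 1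

theorem evalAt_mk (p : Fin r → ℙ k (Fin n → k)) (j : Fin r) (f : MvPolynomial (Fin n) k) :
    evalAt p j (Ideal.Quotient.mk _ f) = eval (p j).rep f :=
  Ideal.Quotient.lift_mk _ _ _

theorem evalAt_smul (p : Fin r → ℙ k (Fin n → k)) (j : Fin r) (f : MvPolynomial (Fin n) k)
    (a : MvPolynomial (Fin n) k ⧸ coneIdeal p) :
    evalAt p j (f • a) = eval (p j).rep f * evalAt p j a := by
  obtain ⟨a, rfl⟩ := Ideal.Quotient.mk_surjective a
  rw [← evalAt_mk, ← map_mul]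
  rfl

/-- At a smooth point of the cone every homomorphism `I → 𝒪` is a directional derivative. -/
theorem exists_directionalDerivative [Infinite k] {p : Fin r → ℙ k (Fin n → k)}
    (hp : Function.Injective p)
    (φ : coneIdeal p →ₗ[MvPolynomial (Fin n) k] (MvPolynomial (Fin n) k ⧸ coneIdeal p))
    (j : Fin r) :
    ∃ w : Fin n → k, ∀ f : coneIdeal p,
      evalAt p j (φ f) = directionalDerivative (p j).rep w f := by
  have hsep : ∀ i, ∃ L : Fin n → k, i ≠ j → L ⬝ᵥ (p i).rep = 0 ∧ L ⬝ᵥ (p j).rep ≠ 0 := by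
    intro i
    by_cases hij : i = j
    · exact ⟨0, fun h => absurd hij h⟩
    · obtain ⟨L, hL⟩ := exists_linear_separating (hp.ne hij)
      exact ⟨L, fun _ => hL⟩
  choose L hL using hsep
  -- `g` vanishes on all lines but the `j`-th and is nonzero at its chosen point. Multiplication by
  -- `g` carries the ideal `J` of that line into `I`, and dividing by the value of `g` afterwards
  -- extends `φ`, evaluated at the point, to `J`.
  let g : MvPolynomial (Fin n) k := ∏ i ∈ Finset.univ.erase j, linearForm (L i)
  have hgj : eval (p j).rep g ≠ 0 := by
    simp only [g, map_prod, eval_linearForm]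
    exact Finset.prod_ne_zero_iff.mpr fun i hi => (hL i (Finset.ne_of_mem_erase hi)).2
  have hgi : ∀ i ≠ j, ∀ t : k, eval (t • (p i).rep) g = 0 := by
    intro i hi t
    simp only [g, map_prod, eval_linearForm, dotProduct_smul]
    exact Finset.prod_eq_zero (Finset.mem_erase.mpr ⟨hi, Finset.mem_univ i⟩)
      (by rw [(hL i hi).1, smul_zero])
  let J : Ideal (MvPolynomial (Fin n) k) := coneIdeal fun _ : Fin 1 => p j
  have hJ : ∀ f, f ∈ J ↔ ∀ t : k, eval (t • (p j).rep) f = 0 := fun f => by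
    simp [J, mem_coneIdeal]
  have hIJ : ∀ f ∈ coneIdeal p, f ∈ J := fun f hf => (hJ f).mpr (mem_coneIdeal.mp hf j)
  have hgJ : ∀ f ∈ J, g * f ∈ coneIdeal p := by
    intro f hf
    refine mem_coneIdeal.mpr fun i t => ?_
    rw [map_mul]
    by_cases hij : i = j
    · rw [hij, (hJ f).mp hf t, mul_zero]
    · rw [hgi i hij, zero_mul]
  let χ : J → k := fun f => (eval (p j).rep g)⁻¹ * evalAt p j (φ ⟨g * f, hgJ f f.2⟩)
  obtain ⟨w, hw⟩ := exists_directionalDerivative_of_line (p j).rep_nonzero J hJ χ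
    (fun f h => by
      have : (⟨g * ↑(f + h), hgJ _ (f + h).2⟩ : coneIdeal p)
          = ⟨g * f, hgJ f f.2⟩ + ⟨g * h, hgJ h h.2⟩ := by
        ext1; simp [mul_add]
      simp only [χ]
      rw [this, map_add, map_add, mul_add])
    (fun a f => by
      have : (⟨g * ↑(a • f), hgJ _ (a • f).2⟩ : coneIdeal p) = a • ⟨g * f, hgJ f f.2⟩ := by
        ext1; simp; ring
      simp only [χ]
      rw [this, map_smul, evalAt_smul, mul_left_comm])
  refine ⟨w, fun f => ?_⟩
  rw [← hw ⟨f, hIJ f f.2⟩]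
  have : (⟨g * f, hgJ _ (hIJ f f.2)⟩ : coneIdeal p) = g • f := by
    ext1; simp
  simp only [χ]
  rw [this, map_smul, evalAt_smul, inv_mul_cancel_left₀ hgj]

/-! ### Self-dual weights from self-association -/

/-- Weights that make the vectors `v j` isotropic, and for which every linear relation between the
`v j` is a weighted linear form. -/
structure IsSelfDualWeight (v : Fin r → Fin n → k) (lam : Fin r → k) : Prop where
  ne_zero : ∀ j, lam j ≠ 0
  isotropic : ∀ a b, ∑ j, lam j * v j a * v j b = 0
  spanning : ∀ x : Fin n → k, ∃ c : Fin r → k, ∑ j, c j • v j = x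
  relation : ∀ y : Fin r → k, (∀ a, ∑ j, y j * v j a = 0) →
    ∃ M : Fin n → k, ∀ j, y j = lam j * M ⬝ᵥ v j

theorem IsCoordinateMatrix.exists_smul {P : Matrix (Fin n) (Fin r) k}
    {p : Fin r → ℙ k (Fin n → k)} (h : IsCoordinateMatrix P p) (j : Fin r) :
    ∃ a : k, a ≠ 0 ∧ P.col j = a • (p j).rep := by
  obtain ⟨h0, h1⟩ := h j
  obtain ⟨a, ha⟩ := (Projectivization.mk_eq_mk_iff k _ _ h0 (p j).rep_nonzero).mp
    (h1.trans (p j).mk_rep.symm)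
  exact ⟨a, a.ne_zero, ha.symm⟩

/-- The columns of `P` are `a j • v j` and those of `Q` are `b j • g (v j)`, so undoing `g` in `P Qᵗ
= 0` gives isotropy for the weights `a j * b j`. The rows of `Q` span the whole kernel of `P`
because both spaces have dimension `2n - n = n`; this gives the statement about relations. -/
theorem IsSelfAssociated.exists_isSelfDualWeight {p : Fin (2 * n) → ℙ k (Fin n → k)}
    (h : IsSelfAssociated p) : ∃ lam, IsSelfDualWeight (fun j => (p j).rep) lam := by
  obtain ⟨q, ⟨-, P, Q, hP, hQ, hPr, hQr, hPQ⟩, g, hg⟩ := h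
  choose a ha0 ha using hP.exists_smul
  have hb : ∀ j, ∃ b : k, b ≠ 0 ∧ Q.col j = b • g (p j).rep := by
    intro j
    obtain ⟨h0, h1⟩ := hQ j
    rw [← hg j, ← (p j).mk_rep, Projectivization.map_mk] at h1
    obtain ⟨b, hb⟩ := (Projectivization.mk_eq_mk_iff k _ _ h0 _).mp h1
    refine ⟨b, b.ne_zero, ?_⟩
    exact hb.symm.trans (by simp [Units.smul_def])
  choose b hb0 hb using hb
  have hPa : ∀ i j, P i j = a j * (p j).rep i := fun i j => congrFun (ha j) i
  have hQb : ∀ j, (fun i => Q i j) = b j • g (p j).rep := hb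
  have hiso : ∀ c d, ∑ j, a j * b j * (p j).rep c * (p j).rep d = 0 := by
    intro c d
    have h1 : ∑ j, P c j • (fun i => Q i j) = 0 := by
      ext i
      have := congrFun (congrFun hPQ c) i
      simpa [Matrix.mul_apply, Finset.sum_apply] using this
    have h2 := congrArg g.symm h1
    simp only [hQb, map_sum, map_smul, LinearEquiv.symm_apply_apply, map_zero, hPa] at h2
    have h3 := congrFun h2 d
    simp only [Finset.sum_apply, Pi.smul_apply, smul_eq_mul, Pi.zero_apply] at h3
    rw [← h3]
    exact Finset.sum_congr rfl fun j _ => by ring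
  have hPsurj : LinearMap.range P.mulVecLin = ⊤ := by
    apply Submodule.eq_top_of_finrank_eq
    rw [Module.finrank_fin_fun]
    exact hPr
  have hspan : ∀ x : Fin n → k, ∃ c : Fin (2 * n) → k, ∑ j, c j • (p j).rep = x := by
    intro x
    obtain ⟨c, hc⟩ := LinearMap.range_eq_top.mp hPsurj x
    refine ⟨fun j => c j * a j, ?_⟩
    rw [← hc]
    ext i
    simp [Matrix.mulVec, dotProduct, hPa, Finset.sum_apply]
    exact Finset.sum_congr rfl fun j _ => by ring
  have hker : LinearMap.range Q.transpose.mulVecLin = LinearMap.ker P.mulVecLin := by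
    apply Submodule.eq_of_le_of_finrank_eq
    · rintro _ ⟨x, rfl⟩
      rw [LinearMap.mem_ker, Matrix.mulVecLin_apply, Matrix.mulVecLin_apply, Matrix.mulVec_mulVec,
        hPQ, Matrix.zero_mulVec]
    · have h1 := P.mulVecLin.finrank_range_add_finrank_ker
      rw [hPsurj, finrank_top, Module.finrank_fin_fun, Module.finrank_fin_fun] at h1
      have h2 : Module.finrank k (LinearMap.range Q.transpose.mulVecLin) = n :=
        (Matrix.rank_transpose Q).trans hQr
      omega
  refine ⟨fun j => a j * b j, fun j => mul_ne_zero (ha0 j) (hb0 j), hiso, hspan, ?_⟩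
  intro y hy
  have hmem : (fun j => y j / a j) ∈ LinearMap.ker P.mulVecLin := by
    rw [LinearMap.mem_ker]
    ext i
    simp only [Matrix.mulVecLin_apply, Matrix.mulVec, dotProduct, hPa, Pi.zero_apply]
    rw [← hy i]
    refine Finset.sum_congr rfl fun j _ => ?_
    have := ha0 j
    field_simp
  rw [← hker] at hmem
  obtain ⟨x, hx⟩ := hmem
  let ψ : (Fin n → k) →ₗ[k] k := (dotProductBilin k k x).comp g.toLinearMap
  refine ⟨fun i => ψ fun j => if i = j then 1 else 0, fun j => ?_⟩
  have h1 := congrFun hx j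
  have h2 : x ⬝ᵥ g (p j).rep =
      (fun i => ψ fun l => if i = l then 1 else 0) ⬝ᵥ (p j).rep := by
    have := LinearMap.pi_apply_eq_sum_univ ψ (p j).rep
    simpa [dotProduct, mul_comm, ψ] using this
  have h3 : Q.transpose.mulVecLin x j = b j * x ⬝ᵥ g (p j).rep := by
    have h4 : Q.transpose.mulVecLin x j = x ⬝ᵥ fun i => Q i j := by
      rw [Matrix.mulVecLin_apply]
      exact dotProduct_comm _ _
    rw [h4, hQb, dotProduct_smul, smul_eq_mul]
  rw [h3, h2, eq_div_iff (ha0 j)] at h1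
  rw [← h1]
  ring

/-! ### The dualising module and uniqueness of the weights -/

/-- If a polynomial times a Laurent polynomial is a nonzero multiple of `T⁻³`, then the Laurent
polynomial has no residue. -/
theorem coeff_neg_one_eq_zero_of_mul_eq {g : Polynomial k} {β : k[T;T⁻¹]} {c : k} (hc : c ≠ 0)
    (h : Polynomial.toLaurent g * β = LaurentPolynomial.C c * LaurentPolynomial.T (-3)) :
    β.coeff (-1) = 0 := by
  obtain ⟨N, B, hB⟩ := LaurentPolynomial.exists_T_pow β
  -- With `β = B T⁻ᴺ`, comparing degrees gives `N ≥ 3` and `deg B ≤ N - 3`, so the coefficient of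
  -- `B` in degree `N - 1` vanishes.
  have h1 : g * B * Polynomial.X ^ 3 = Polynomial.C c * Polynomial.X ^ N := by
    apply Polynomial.toLaurent_injective
    simp only [map_mul, Polynomial.toLaurent_X_pow, Polynomial.toLaurent_C, hB]
    rw [← mul_assoc (Polynomial.toLaurent g), h, LaurentPolynomial.mul_T_assoc,
      LaurentPolynomial.mul_T_assoc]
    congr 2
    push_cast
    ring
  have h0 : g * B * Polynomial.X ^ 3 ≠ 0 := by
    rw [h1]
    exact mul_ne_zero (Polynomial.C_ne_zero.mpr hc) (pow_ne_zero _ Polynomial.X_ne_zero)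
  have hgB := left_ne_zero_of_mul h0
  have h2 := congrArg Polynomial.natDegree h1
  rw [Polynomial.natDegree_mul hgB (pow_ne_zero _ Polynomial.X_ne_zero),
    Polynomial.natDegree_mul (left_ne_zero_of_mul hgB) (right_ne_zero_of_mul hgB),
    Polynomial.natDegree_C_mul_X_pow _ _ hc, Polynomial.natDegree_X_pow] at h2
  have h3 : β = Polynomial.toLaurent B * LaurentPolynomial.T (-N) := by
    rw [hB, LaurentPolynomial.mul_T_assoc, add_neg_cancel, LaurentPolynomial.T_zero, mul_one]
  have h4 : (Polynomial.toLaurent B).coeff ((N - 1 : ℕ) : ℤ) = B.coeff (N - 1) :=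
    Finsupp.mapDomain_apply Nat.castEmbedding.injective _ _
  have h5 : β.coeff (-1) = (Polynomial.toLaurent B).coeff ((N - 1 : ℕ) : ℤ) := by
    rw [h3, LaurentPolynomial.T, AddMonoidAlgebra.coeff_mul_single_apply, mul_one]
    congr 1
    omega
  rw [h5, h4]
  exact Polynomial.coeff_eq_zero_of_natDegree_lt (by omega)

/-- Restriction of a polynomial to a line through the origin. -/
noncomputable def restrictToLine (v : Fin n → k) : MvPolynomial (Fin n) k →ₐ[k] Polynomial k :=
  aeval fun i => Polynomial.C (v i) * Polynomial.X

theorem restrictToLines_apply (p : Fin r → ℙ k (Fin n → k)) (f : MvPolynomial (Fin n) k)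
    (j : Fin r) :
    restrictToLines p f j = Polynomial.toLaurent (restrictToLine (p j).rep f) := by
  have h : (Pi.evalAlgHom k _ j).comp (restrictToLines p) =
      (Polynomial.toLaurentAlg (R := k)).comp (restrictToLine (p j).rep) := by
    apply MvPolynomial.algHom_ext
    intro i
    simp [restrictToLines, restrictToLine]
  exact DFunLike.congr_fun h f

theorem restrictToLine_coeff_zero (v : Fin n → k) (f : MvPolynomial (Fin n) k) :
    (restrictToLine v f).coeff 0 = constantCoeff f := by
  have h : (Polynomial.constantCoeff : Polynomial k →+* k).comp
      (restrictToLine v : MvPolynomial (Fin n) k →+* Polynomial k) = constantCoeff := by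
    apply MvPolynomial.ringHom_ext
    · intro c
      simp [restrictToLine]
    · intro i
      simp [restrictToLine]
  exact DFunLike.congr_fun h f

theorem restrictToLine_of_isHomogeneous {d : ℕ} (v : Fin n → k) {f : MvPolynomial (Fin n) k}
    (hf : f.IsHomogeneous d) :
    restrictToLine v f = Polynomial.C (eval v f) * Polynomial.X ^ d := by
  rw [restrictToLine, aeval_def, eval₂_eq', eval_eq', map_sum, Finset.sum_mul]
  refine Finset.sum_congr rfl fun m hm => ?_
  have h : m.degree = d := (hf.degree_eq_sum_deg_support hm).symm
  simp only [mul_pow, Finset.prod_mul_distrib]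
  rw [Finset.prod_pow_eq_pow_sum, ← Finsupp.degree_eq_sum, h]
  simp [mul_assoc]

theorem smul_lineDifferentials_apply (p : Fin r → ℙ k (Fin n → k)) (f : MvPolynomial (Fin n) k)
    (α : LineDifferentials p) (j : Fin r) : (f • α) j = restrictToLines p f j * α j := rfl

theorem residueSum_apply (p : Fin r → ℙ k (Fin n → k)) (α : LineDifferentials p) :
    residueSum p α = ∑ j, (α j).coeff (-1) := rfl

theorem exists_eq_linearForm {f : MvPolynomial (Fin n) k} (hf : f.IsHomogeneous 1) :
    ∃ L, f = linearForm L := by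
  rw [← mem_homogeneousSubmodule, homogeneousSubmodule_one_eq_span_X,
    Submodule.mem_span_range_iff_exists_fun] at hf
  obtain ⟨c, hc⟩ := hf
  exact ⟨c, by simp [← hc, linearForm, MvPolynomial.smul_eq_C_mul]⟩

/-- Weights that make the vectors `v j` isotropic annihilate all quadratic forms. -/
theorem sum_mul_eval_eq_zero_of_isotropic {v : Fin r → Fin n → k} {lam : Fin r → k}
    (h : ∀ a b, ∑ j, lam j * v j a * v j b = 0) {f : MvPolynomial (Fin n) k}
    (hf : f.IsHomogeneous 2) : ∑ j, lam j * eval (v j) f = 0 := by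
  rw [← mem_homogeneousSubmodule, ← homogeneousSubmodule_one_pow, pow_two] at hf
  induction hf using Submodule.mul_induction_on' with
  | mem_mul_mem f hf g hg =>
    obtain ⟨L, rfl⟩ := exists_eq_linearForm hf
    obtain ⟨M, rfl⟩ := exists_eq_linearForm hg
    simp only [map_mul, eval_linearForm, dotProduct, Finset.sum_mul, Finset.mul_sum]
    rw [Finset.sum_comm]
    refine Finset.sum_eq_zero fun a _ => ?_
    rw [Finset.sum_comm]
    refine Finset.sum_eq_zero fun b _ => ?_
    have := congrArg (L b * M a * ·) (h b a)
    simp only [Finset.mul_sum, mul_zero] at this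
    rw [← this]
    exact Finset.sum_congr rfl fun j _ => by ring
  | add f hf g hg ihf ihg => simp [mul_add, Finset.sum_add_distrib, ihf, ihg]

/-- The differentials `(lam j * t⁻³ dt)`. -/
noncomputable def cubicPole (p : Fin r → ℙ k (Fin n → k)) (lam : Fin r → k) :
    LineDifferentials p :=
  fun j => LaurentPolynomial.C (lam j) * LaurentPolynomial.T (-3)

/-- A form of degree `d` turns the exponent `-3` into `d - 3`, so only quadrics contribute residues,
and isotropy cancels those. -/
theorem cubicPole_mem {p : Fin r → ℙ k (Fin n → k)} {lam : Fin r → k}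
    (h : ∀ a b, ∑ j, lam j * (p j).rep a * (p j).rep b = 0) :
    cubicPole p lam ∈ dualisingModule p := by
  intro f
  rw [← sum_homogeneousComponent f, Finset.sum_smul, map_sum]
  refine Finset.sum_eq_zero fun d _ => ?_
  have hd := homogeneousComponent_isHomogeneous d f
  set g := homogeneousComponent d f
  have h1 : ∀ j, ((g • cubicPole p lam) j).coeff (-1) =
      if d = 2 then lam j * eval (p j).rep g else 0 := by
    intro j
    have h2 : (g • cubicPole p lam) j =
        LaurentPolynomial.C (eval (p j).rep g * lam j) * LaurentPolynomial.T (d - 3) := by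
      rw [smul_lineDifferentials_apply, restrictToLines_apply,
        restrictToLine_of_isHomogeneous _ hd, map_mul, Polynomial.toLaurent_C,
        Polynomial.toLaurent_X_pow, cubicPole, map_mul, sub_eq_add_neg, LaurentPolynomial.T_add]
      ring
    rw [h2, ← LaurentPolynomial.single_eq_C_mul_T, AddMonoidAlgebra.coeff_single,
      Finsupp.single_apply, mul_comm]
    exact if_congr (by omega) rfl rfl
  rw [residueSum_apply, Finset.sum_congr rfl fun j _ => h1 j]
  split_ifs with h2
  · subst h2
    exact sum_mul_eval_eq_zero_of_isotropic h hd
  · exact Finset.sum_const_zero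

/-- For a Gorenstein cone with self-dual weights, the weights are up to a scalar the only ones that
annihilate all quadratic forms. -/
theorem IsGorensteinCone.exists_eq_mul_weight {p : Fin r → ℙ k (Fin n → k)}
    (hG : IsGorensteinCone p) {lam : Fin r → k} (hlam : IsSelfDualWeight (fun j => (p j).rep) lam)
    {u : Fin r → k} (hu : ∀ a b, ∑ j, u j * (p j).rep a * (p j).rep b = 0) :
    ∃ c : k, ∀ j, u j = c * lam j := by
  obtain ⟨e⟩ := hG
  set β : dualisingModule p := e.symm 1 with hβ
  have hgen : ∀ γ : dualisingModule p, ∃ f : MvPolynomial (Fin n) k, γ = f • β := by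
    intro γ
    obtain ⟨f, hf⟩ := Ideal.Quotient.mk_surjective (e γ)
    refine ⟨f, e.injective ?_⟩
    rw [map_smul, hβ, e.apply_symm_apply, ← hf, ← map_one (Ideal.Quotient.mk _)]
    exact congrArg (Ideal.Quotient.mk _) (mul_one f).symm
  obtain ⟨q, hq⟩ := hgen ⟨_, cubicPole_mem hlam.isotropic⟩
  have hqj : ∀ j, Polynomial.toLaurent (restrictToLine (p j).rep q) * (β : LineDifferentials p) j =
      LaurentPolynomial.C (lam j) * LaurentPolynomial.T (-3) := by
    intro j
    rw [← restrictToLines_apply]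
    exact (congrFun (congrArg Subtype.val hq) j).symm
  -- The generator divides the cubic pole by a polynomial on each line, so its pole there has order
  -- at least 3 and it has no residue.
  have hres : ∀ j, ((β : LineDifferentials p) j).coeff (-1) = 0 := fun j =>
    coeff_neg_one_eq_zero_of_mul_eq (hlam.ne_zero j) (hqj j)
  have hne : ∀ j, (β : LineDifferentials p) j ≠ 0 := by
    intro j h0
    have h1 := hqj j
    rw [h0, mul_zero, ← LaurentPolynomial.single_eq_C_mul_T, eq_comm,
      AddMonoidAlgebra.single_eq_zero] at h1
    exact hlam.ne_zero j h1
  choose M hM using fun a => hlam.relation (fun j => u j * (p j).rep a) (hu a)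
  -- Membership of `γ` in `ω` is tested on constants, where `β` has no residue on any line, and on
  -- multiples of each `x_a`, where `x_a γ = M_a β` for the linear form `M_a` given by the relation
  -- `u j * v j a`.
  let γ : LineDifferentials p := fun j =>
    LaurentPolynomial.C (u j / lam j) * (β : LineDifferentials p) j
  have hγ : γ ∈ dualisingModule p := by
    intro f
    induction f using MvPolynomial.induction_on with
    | C a =>
      rw [residueSum_apply]
      refine Finset.sum_eq_zero fun j _ => ?_
      rw [smul_lineDifferentials_apply, restrictToLines_apply]
      simp only [restrictToLine, algHom_C, Polynomial.algebraMap_eq, Polynomial.toLaurent_C, γ]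
      rw [← mul_assoc, ← map_mul, ← LaurentPolynomial.smul_eq_C_mul, AddMonoidAlgebra.coeff_smul,
        Finsupp.smul_apply, hres, smul_zero]
    | add f g hf hg => rw [add_smul, map_add, hf, hg, add_zero]
    | mul_X f a _ =>
      have h1 : (f * X a) • γ = (f * linearForm (M a)) • (β : LineDifferentials p) := by
        funext j
        have h2 := hM a j
        have h3 : (p j).rep a * (u j / lam j) = M a ⬝ᵥ (p j).rep := by
          have := hlam.ne_zero j
          field_simp
          linear_combination h2
        have h4 : γ j = LaurentPolynomial.C (u j / lam j) * (β : LineDifferentials p) j := rfl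
        rw [smul_lineDifferentials_apply, smul_lineDifferentials_apply, h4]
        simp only [restrictToLines_apply, map_mul,
          restrictToLine_of_isHomogeneous _ (isHomogeneous_X k a),
          restrictToLine_of_isHomogeneous _ (linearForm_isHomogeneous (M a)), eval_X,
          eval_linearForm, Polynomial.toLaurent_C, ← h3]
        ring
      rw [h1]
      exact β.2 _
  obtain ⟨f, hf⟩ := hgen ⟨γ, hγ⟩
  refine ⟨constantCoeff f, fun j => ?_⟩
  have h1 : LaurentPolynomial.C (u j / lam j) * (β : LineDifferentials p) j =
      restrictToLines p f j * (β : LineDifferentials p) j := congrFun (congrArg Subtype.val hf) j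
  -- On each line `f` restricts to the constant `u j / lam j`; all these restrictions share the
  -- constant term of `f`.
  have h2 := mul_right_cancel₀ (hne j) h1
  rw [restrictToLines_apply, ← Polynomial.toLaurent_C, Polynomial.toLaurent_inj] at h2
  rw [← restrictToLine_coeff_zero (p j).rep, ← h2, Polynomial.coeff_C_zero,
    div_mul_cancel₀ _ (hlam.ne_zero j)]

/-! ### Interpolation by forms of degree at least two -/

/-- For a Gorenstein cone over at least two points, weights that annihilate all forms of some degree
`m ≥ 2` are a multiple of the self-dual weights. -/
theorem IsGorensteinCone.exists_eq_mul_weight_of_degree [Nontrivial (Fin r)]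
    {p : Fin r → ℙ k (Fin n → k)}
    (hp : Function.Injective p) (hG : IsGorensteinCone p) {lam : Fin r → k}
    (hlam : IsSelfDualWeight (fun j => (p j).rep) lam) {m : ℕ} (hm : 2 ≤ m) :
    ∀ {u : Fin r → k}, (∀ f : MvPolynomial (Fin n) k, f.IsHomogeneous m →
      ∑ j, u j * eval (p j).rep f = 0) → ∃ c : k, ∀ j, u j = c * lam j := by
  induction m, hm using Nat.le_induction with
  | base =>
    intro u hu
    refine hG.exists_eq_mul_weight hlam fun a b => ?_
    rw [← hu (X a * X b) ((isHomogeneous_X k a).mul (isHomogeneous_X k b))]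
    simp [mul_assoc]
  | succ m hm ih =>
    intro u hu
    -- Beyond degree 2 no nonzero weights survive: with `L` zero at point `i` and nonzero at point
    -- `j`, the weights `u * L` are `c * lam`; point `i` gives `c = 0`, and then point `j` gives `u
    -- j = 0`.
    refine ⟨0, fun j => ?_⟩
    obtain ⟨i, hij⟩ := exists_ne j
    obtain ⟨L, hLi, hLj⟩ := exists_linear_separating (hp.ne hij)
    obtain ⟨c, hc⟩ := ih (u := fun j => u j * L ⬝ᵥ (p j).rep) fun f hf => by
      rw [← hu (f * linearForm L) (hf.mul (linearForm_isHomogeneous L))]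
      refine Finset.sum_congr rfl fun j _ => ?_
      rw [map_mul, eval_linearForm]
      ring
    have h1 := hc i
    have h2 := hc j
    simp only [hLi, mul_zero] at h1
    rw [(mul_eq_zero_iff_right (hlam.ne_zero i)).mp h1.symm, zero_mul] at h2
    rw [zero_mul, (mul_eq_zero_iff_right hLj).mp h2]

/-- For a Gorenstein cone, values on the points that are orthogonal to the self-dual weights are the
values of forms of any given degree `m ≥ 2`. -/
theorem IsGorensteinCone.exists_isHomogeneous_eval_eq [Nontrivial (Fin r)]
    {p : Fin r → ℙ k (Fin n → k)}
    (hp : Function.Injective p) (hG : IsGorensteinCone p) {lam : Fin r → k}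
    (hlam : IsSelfDualWeight (fun j => (p j).rep) lam) {m : ℕ} (hm : 2 ≤ m) {y : Fin r → k}
    (hy : ∑ j, lam j * y j = 0) :
    ∃ f : MvPolynomial (Fin n) k, f.IsHomogeneous m ∧ ∀ j, eval (p j).rep f = y j := by
  let E : MvPolynomial (Fin n) k →ₗ[k] (Fin r → k) :=
    LinearMap.pi fun j => (aeval (p j).rep).toLinearMap
  have hE : ∀ f j, E f j = eval (p j).rep f := fun f j => by simp [E, aeval_eq_eval]
  suffices h : y ∈ (homogeneousSubmodule (Fin n) k m).map E by
    obtain ⟨f, hf, rfl⟩ := h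
    exact ⟨f, hf, fun j => (hE f j).symm⟩
  by_contra hyS
  -- A functional separating `y` from the attained values is a system of weights annihilating all
  -- forms of degree `m`, hence a multiple of `lam`, and so it kills `y` after all.
  obtain ⟨φ, hφ, hle⟩ := Submodule.exists_le_ker_of_notMem hyS
  apply hφ
  have hφa : ∀ x, φ x = ∑ j, (φ fun i => if j = i then 1 else 0) * x j := fun x => by
    rw [LinearMap.pi_apply_eq_sum_univ φ x]
    simp [mul_comm]
  obtain ⟨c, hc⟩ := hG.exists_eq_mul_weight_of_degree hp hlam hm
    (u := fun j => φ fun i => if j = i then 1 else 0) fun f hf => by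
      simp only [← hE, ← hφa]
      exact hle ⟨f, hf, rfl⟩
  rw [hφa, Finset.sum_congr rfl fun j _ => by rw [hc j, mul_assoc], ← Finset.mul_sum, hy, mul_zero]

/-! ### Gradings, derivations and the vanishing of positive parts -/

theorem restrictToLine_coeff (v : Fin n → k) (f : MvPolynomial (Fin n) k) (d : ℕ) :
    (restrictToLine v f).coeff d = eval v (homogeneousComponent d f) := by
  conv_lhs => rw [← sum_homogeneousComponent f, map_sum, Polynomial.finsetSum_coeff]
  rw [Finset.sum_eq_single d]
  · simp [restrictToLine_of_isHomogeneous v (homogeneousComponent_isHomogeneous d f)]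
  · intro e _ he
    simp [restrictToLine_of_isHomogeneous v (homogeneousComponent_isHomogeneous e f),
      Polynomial.coeff_X_pow, he.symm]
  · intro hd
    rw [homogeneousComponent_eq_zero _ _ (by simpa [Nat.lt_succ_iff] using hd), map_zero,
      Polynomial.coeff_zero]

theorem eval_restrictToLine (v : Fin n → k) (f : MvPolynomial (Fin n) k) (t : k) :
    (restrictToLine v f).eval t = eval (t • v) f := by
  have h : (Polynomial.aeval t).comp (restrictToLine v) = aeval (t • v) := by
    apply MvPolynomial.algHom_ext
    intro i
    simp only [restrictToLine, AlgHom.comp_apply, aeval_X, map_mul, Polynomial.aeval_C,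
      Polynomial.aeval_X, Algebra.algebraMap_self, RingHom.id_apply, Pi.smul_apply, smul_eq_mul]
    ring
  simpa [aeval_eq_eval, Polynomial.coe_aeval_eq_eval] using DFunLike.congr_fun h f

/-- Over an infinite field, vanishing on a line kills every coefficient of the restriction, and
these are the values of the homogeneous components. -/
theorem homogeneousComponent_mem_coneIdeal [Infinite k] {p : Fin r → ℙ k (Fin n → k)}
    {f : MvPolynomial (Fin n) k} (hf : f ∈ coneIdeal p) (d : ℕ) :
    homogeneousComponent d f ∈ coneIdeal p := by
  refine mem_coneIdeal_of_isHomogeneous (homogeneousComponent_isHomogeneous d f) fun j => ?_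
  have h : restrictToLine (p j).rep f = 0 := Polynomial.funext fun t => by
    rw [eval_restrictToLine, mem_coneIdeal.mp hf, Polynomial.eval_zero]
  rw [← restrictToLine_coeff, h, Polynomial.coeff_zero]

theorem mkDerivation_quotient_apply (I : Ideal (MvPolynomial (Fin n) k))
    (Y : Fin n → MvPolynomial (Fin n) k) (f : MvPolynomial (Fin n) k) :
    mkDerivation k (fun i => Ideal.Quotient.mk I (Y i)) f =
      Ideal.Quotient.mk I (∑ i, pderiv i f * Y i) := by
  have h : mkDerivation k (fun i => Ideal.Quotient.mk I (Y i)) =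
      I.mkQ.compDer (mkDerivation k Y) := by
    apply MvPolynomial.derivation_ext
    intro i
    rw [mkDerivation_X]
    exact (congrArg (Ideal.Quotient.mk I) (mkDerivation_X k Y i)).symm
  have h1 : mkDerivation k Y f = ∑ i, pderiv i f * Y i := by
    induction f using MvPolynomial.induction_on with
    | C a => simp
    | add f g hf hg => simp only [map_add, hf, hg, add_mul, Finset.sum_add_distrib]
    | mul_X f j hf =>
      simp only [Derivation.leibniz, hf, mkDerivation_X, pderiv_X, smul_eq_mul, add_mul,
        Finset.sum_add_distrib, Finset.mul_sum, Pi.single_apply, mul_ite, ite_mul, mul_one,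
        mul_zero, zero_mul, Finset.sum_ite_eq, Finset.mem_univ, if_true, mul_assoc]
  rw [h, ← h1]
  rfl

theorem sum_pderiv_mul_isHomogeneous {d e : ℕ} {f : MvPolynomial (Fin n) k}
    (hf : f.IsHomogeneous d) {Y : Fin n → MvPolynomial (Fin n) k}
    (hY : ∀ i, (Y i).IsHomogeneous (e + 1)) :
    (∑ i, pderiv i f * Y i).IsHomogeneous (d + e) := by
  refine IsHomogeneous.sum _ _ _ fun i _ => ?_
  -- Constants are treated separately because the degree `d - 1` of a partial derivative is
  -- truncated at `d = 0`.
  rcases d with _ | d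
  · rw [totalDegree_eq_zero_iff_eq_C.mp (Nat.le_zero.mp hf.totalDegree_le), pderiv_C,
      zero_mul]
    exact isHomogeneous_zero _ _ _
  · have := (hf.pderiv (i := i)).mul (hY i)
    rwa [show d + 1 - 1 + (e + 1) = d + 1 + e by omega] at this

theorem mem_range_jacobianMap_of_pos [Infinite k] [Nontrivial (Fin r)]
    {p : Fin r → ℙ k (Fin n → k)} (hp : Function.Injective p) (hG : IsGorensteinCone p)
    {lam : Fin r → k} (hlam : IsSelfDualWeight (fun j => (p j).rep) lam) {l : ℤ} (hl : 0 < l)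
    {φ : coneIdeal p →ₗ[MvPolynomial (Fin n) k] (MvPolynomial (Fin n) k ⧸ coneIdeal p)}
    (hφ : φ ∈ normalPart (coneIdeal p) l) :
    φ ∈ LinearMap.range (jacobianMap (coneIdeal p)) := by
  lift l to ℕ using hl.le
  choose w hw using exists_directionalDerivative hp φ
  -- Adding `(c j / lam j) • v j` to `w j` makes the weighted sum zero without changing the
  -- derivatives of forms in `I`.
  obtain ⟨c, hc⟩ := hlam.spanning (-∑ j, lam j • w j)
  have hy : ∀ i, ∑ j, lam j * (w j i + c j / lam j * (p j).rep i) = 0 := by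
    intro i
    have h1 := congrFun hc i
    simp only [Finset.sum_apply, Pi.smul_apply, smul_eq_mul, Pi.neg_apply] at h1
    simp only [mul_add, Finset.sum_add_distrib]
    rw [add_comm, ← eq_neg_iff_add_eq_zero, ← h1]
    refine Finset.sum_congr rfl fun j _ => ?_
    have := hlam.ne_zero j
    field_simp
  choose Y hYh hYe using fun i =>
    hG.exists_isHomogeneous_eval_eq hp hlam (m := l + 1) (by omega) (hy i)
  refine ⟨mkDerivation k fun i => Ideal.Quotient.mk _ (Y i), ?_⟩
  have hhom : ∀ (d : ℕ) (f : coneIdeal p), (f : MvPolynomial (Fin n) k).IsHomogeneous d →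
      jacobianMap (coneIdeal p) (mkDerivation k fun i => Ideal.Quotient.mk _ (Y i)) f = φ f := by
    intro d f hf
    obtain ⟨G, hG, hGφ⟩ : ∃ G : MvPolynomial (Fin n) k, G.IsHomogeneous (d + l) ∧
        Ideal.Quotient.mk (coneIdeal p) G = φ f := by
      have := hφ d f hf
      rw [quotientPart, if_pos (by positivity)] at this
      obtain ⟨G, hG, h⟩ := this
      exact ⟨G, hG, h⟩
    refine (mkDerivation_quotient_apply _ Y f).trans ?_
    rw [← hGφ, Ideal.Quotient.mk_eq_mk_iff_sub_mem]
    -- Both sides are represented by forms of degree `d + l`, so agreement at one nonzero point of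
    -- each line suffices.
    refine mem_coneIdeal_of_isHomogeneous ((sum_pderiv_mul_isHomogeneous hf hYh).sub hG) fun j => ?_
    have h0 : directionalDerivative (p j).rep (p j).rep (f : MvPolynomial (Fin n) k) = 0 := by
      have := mem_coneIdeal.mp f.2 j 1
      rw [one_smul] at this
      rw [directionalDerivative_self _ hf, this, mul_zero]
    rw [map_sub, sub_eq_zero, ← evalAt_mk, ← evalAt_mk, hGφ, hw, evalAt_mk, map_sum]
    simp only [map_mul, hYe, mul_add, Finset.sum_add_distrib]
    rw [← directionalDerivative_apply]
    rw [directionalDerivative_apply] at h0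
    have h1 : ∑ i, eval (p j).rep (pderiv i (f : MvPolynomial (Fin n) k)) *
        (c j / lam j * (p j).rep i) = c j / lam j * 0 := by
      rw [← h0, Finset.mul_sum]
      exact Finset.sum_congr rfl fun i _ => by ring
    rw [h1, mul_zero, add_zero]
  ext f
  have hf : f = ∑ d ∈ Finset.range ((f : MvPolynomial (Fin n) k).totalDegree + 1),
      (⟨_, homogeneousComponent_mem_coneIdeal f.2 d⟩ : coneIdeal p) := by
    ext1
    rw [AddSubmonoidClass.coe_finsetSum, sum_homogeneousComponent]
  rw [hf, map_sum, map_sum]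
  exact Finset.sum_congr rfl fun d _ => hhom d _ (homogeneousComponent_isHomogeneous d _)

end

end LinesCone


theorem mainTheorem11 {k : Type*} [Field k] [IsAlgClosed k] [CharZero k] (n : ℕ)
    (p : Fin (2 * n) → ℙ k (Fin n → k)) (hdistinct : Function.Injective p)
    (hself : LinesCone.IsSelfAssociated p) (hGor : LinesCone.IsGorensteinCone p) :
    LinesCone.IsNegativelyGraded (LinesCone.coneIdeal p) := by
  intro l hl
  rw [eq_bot_iff]
  rintro _ ⟨φ, hφ, rfl⟩
  rw [Submodule.mem_bot, LinearMap.restrictScalars_apply, Submodule.mkQ_apply,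
    Submodule.Quotient.mk_eq_zero]
  rcases n with _ | n
  -- For `n = 0` there are no points, the ideal is everything and `𝒪 = 0`; otherwise there are at
  -- least two points, as the induction on degree requires.
  · refine ⟨0, LinearMap.ext fun f => ?_⟩
    have h : LinesCone.coneIdeal p = ⊤ := by
      rw [eq_top_iff]
      exact fun g _ => LinesCone.mem_coneIdeal.mpr fun j => j.elim0
    have := Ideal.Quotient.subsingleton_iff.mpr h
    exact Subsingleton.elim _ _
  · have : Nontrivial (Fin (2 * (n + 1))) := Fin.nontrivial_iff_two_le.mpr (by omega)
    obtain ⟨lam, hlam⟩ := hself.exists_isSelfDualWeight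
    exact LinesCone.mem_range_jacobianMap_of_pos hdistinct hGor hlam hl hφ
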